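/- Let $(\Omega,\mu)$ be a $\sigma$-finite measure space with a non-atomic measure $\mu$, and let $\mathcal M(\Omega,\mu)$ be the space of all (real- or complex-valued) $\mu$-measurable functions on $\Omega$, where functions equal $\mu$-a.e. are identified. For $f\in\mathcal M(\Omega,\mu)$ let $f^*(t)=\inf\{\lambda\ge 0:\mu(\{|f|>\lambda\})\le t\}$ ($t>0$) be its non-increasing rearrangement. Write $\|\cdot\|_{q,I}$ for the (quasi-)norm of $L_q(I)$ on an interval $I\subseteq(0,\infty)$, with the convention $1/\infty=0$. For $0<\kappa<\infty$ let $L_\kappa$ and $L_\infty$ be the Lebesgue spaces on $(\Omega,\mu)$, and let $L_{\kappa,\infty}$ be the space of all $f\in\mathcal M(\Omega,\mu)$ with $\|f\|_{\kappa,\infty}=\sup_{t>0}t^{1/\kappa}f^*(t)<\infty$. A Lebesgue measurable function $b:(0,\infty)\to(0,\infty)$ is called slowly varying ($b\in SV$) if for every $\varepsilon>0$ the function $t\mapsto t^{\varepsilon}b(t)$ is equivalent to a non-decreasing function and $t\mapsto t^{-\varepsilon}b(t)$ is equivalent to a non-increasing function; here $g\approx h$ means $C^{-1}h\le g\le Ch$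 on $(0,\infty)$ for some constant $C>0$. For a couple $(A_0,A_1)$ of quasi-normed spaces contained in $\mathcal M(\Omega,\mu)$, $f\in A_0+A_1$ and $t>0$, let $$K(t,f;A_0,A_1)=\inf\{\|f_0\|_{A_0}+t\|f_1\|_{A_1}: f=f_0+f_1,\ f_i\in A_i\}.$$ For $0\le\theta\le1$, $0<q,r,s\le\infty$ and $a,b,c\in SV$, the extremal interpolation space $(A_0,A_1)^{\mathcal R,\mathcal L}_{\theta,s,c,r,b,q,a}$ consists of all $f\in A_0+A_1$ for which the quasi-norm $$\bigg\|t^{-\frac1s}c(t)\Big\|u^{-\frac1r}b(u)\big\|v^{-\theta-\frac1q}a(v)K(v,f;A_0,A_1)\big\|_{q,(u,t)}\Big\|_{r,(0,t)}\bigg\|_{s,(0,\infty)}$$ is finite. For $0<p\le\infty$, the space $L^{\mathcal R,\mathcal L}_{p,(s,c,r,b,q,a)}$ consists of all $f\in\mathcal M(\Omega,\mu)$ for which the quasi-norm $$\bigg\|t^{-\frac1s}c(t)\Big\|u^{-\frac1r}b(u)\big\|v^{\frac1p-\frac1q}a(v)f^*(v)\big\|_{q,(u,t)}\Big\|_{r,(0,t)}\bigg\|_{s,(0,\infty)}$$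 is finite. **Theorem.** Let $0<\theta\le1$, $0<\kappa<\infty$, $p=\frac{\kappa}{1-\theta}$ (so $p=\infty$ if $\theta=1$), $0<q,r,s\le\infty$ and $a,b,c\in SV$. Put $\tilde a(t)=a(t^{1/\kappa})$, $\tilde b(t)=b(t^{1/\kappa})$ and $\tilde c(t)=c(t^{1/\kappa})$ for $t>0$. Then $$(L_\kappa,L_\infty)^{\mathcal R,\mathcal L}_{\theta,s,c,r,b,q,a}=(L_{\kappa,\infty},L_\infty)^{\mathcal R,\mathcal L}_{\theta,s,c,r,b,q,a}=L^{\mathcal R,\mathcal L}_{p,(s,\tilde c,r,\tilde b,q,\tilde a)},$$ where equality of spaces means that they consist of the same functions and that their quasi-norms are equivalent. -/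

import Mathlib

open MeasureTheory Set
open scoped ENNReal

namespace RLInterp

noncomputable section

/-- A measure without atoms in the measure-theoretic sense: every measurable set of positive
measure splits into two measurable pieces of positive measure.
(The Mathlib class `NoAtoms` only says that singletons are null.) -/
def NonAtomic {Ω : Type*} [MeasurableSpace Ω] (μ : Measure Ω) : Prop :=
  ∀ A : Set Ω, MeasurableSet A → μ A ≠ 0 →
    ∃ B : Set Ω, B ⊆ A ∧ MeasurableSet B ∧ μ B ≠ 0 ∧ μ (A \ B) ≠ 0

/-- Equivalence of two functions on `(0,∞)`, up to a multiplicative constant. -/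
def EquivOn (f g : ℝ → ℝ) : Prop :=
  ∃ C : ℝ, 0 < C ∧ ∀ t : ℝ, 0 < t → f t ≤ C * g t ∧ g t ≤ C * f t

/-- Slowly varying functions on `(0,∞)`; the values of `b` outside `(0,∞)` play no role. -/
structure SlowlyVarying (b : ℝ → ℝ) : Prop where
  pos : ∀ t : ℝ, 0 < t → 0 < b t
  measurable : AEMeasurable b (volume.restrict (Ioi (0 : ℝ)))
  equiv_increasing : ∀ ε : ℝ, 0 < ε →
    ∃ g : ℝ → ℝ, MonotoneOn g (Ioi 0) ∧ EquivOn (fun t => t ^ ε * b t) g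
  equiv_decreasing : ∀ ε : ℝ, 0 < ε →
    ∃ g : ℝ → ℝ, AntitoneOn g (Ioi 0) ∧ EquivOn (fun t => t ^ (-ε) * b t) g

/-- The weighted `L_q` (quasi-)norm `‖ u ^ (σ - 1/q) * b u * g u ‖_{q, I}` over a set `I ⊆ (0,∞)`,
where `1/∞ = 0`. -/
def wnorm (q : ℝ≥0∞) (σ : ℝ) (b : ℝ → ℝ) (I : Set ℝ) (g : ℝ → ℝ≥0∞) : ℝ≥0∞ :=
  eLpNorm (fun u : ℝ => ENNReal.ofReal (u ^ (σ - (q⁻¹).toReal) * b u) * g u) q (volume.restrict I)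

/-- The iterated quantity
`‖ t^(-1/s) c(t) ‖ u^(-1/r) b(u) ‖ v^(σ-1/q) a(v) g(v) ‖_{q,(u,t)} ‖_{r,(0,t)} ‖_{s,(0,∞)}`. -/
def normRL (σ : ℝ) (s : ℝ≥0∞) (c : ℝ → ℝ) (r : ℝ≥0∞) (b : ℝ → ℝ) (q : ℝ≥0∞) (a : ℝ → ℝ)
    (g : ℝ → ℝ≥0∞) : ℝ≥0∞ :=
  wnorm s 0 c (Ioi 0) fun t =>
    wnorm r 0 b (Ioo 0 t) fun u =>
      wnorm q σ a (Ioo u t) g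

section Spaces

variable {Ω : Type*} [MeasurableSpace Ω]

/-- A space of (classes of) measurable functions together with a quasi-norm. The linear structure
is the one of the space `Ω →ₘ[μ] 𝕜` of all classes of measurable functions. -/
structure FunctionSpace (𝕜 : Type*) [RCLike 𝕜] (μ : Measure Ω) where
  carrier : Set (Ω →ₘ[μ] 𝕜)
  qnorm : (Ω →ₘ[μ] 𝕜) → ℝ≥0∞

variable {𝕜 : Type*} [RCLike 𝕜] {μ : Measure Ω}

/-- Continuous embedding. -/
def FunctionSpace.Embeds (X Y : FunctionSpace 𝕜 μ) : Prop :=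
  X.carrier ⊆ Y.carrier ∧
    ∃ C : ℝ, 0 < C ∧ ∀ f ∈ X.carrier, Y.qnorm f ≤ ENNReal.ofReal C * X.qnorm f

/-- Equality of spaces: the same functions, with equivalent quasi-norms. -/
def FunctionSpace.Same (X Y : FunctionSpace 𝕜 μ) : Prop :=
  X.Embeds Y ∧ Y.Embeds X

/-- The space of all measurable functions for which a given functional is finite. -/
def FunctionSpace.ofFinite (N : (Ω →ₘ[μ] 𝕜) → ℝ≥0∞) : FunctionSpace 𝕜 μ where
  carrier := {f | N f < ∞}
  qnorm := N

/-- The non-increasing rearrangement `f*(t) = inf {l ≥ 0 : μ {|f| > l} ≤ t}`. -/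
def rearr (f : Ω →ₘ[μ] 𝕜) (t : ℝ) : ℝ≥0∞ :=
  sInf {l : ℝ≥0∞ | μ {x | l < ‖f x‖ₑ} ≤ ENNReal.ofReal t}

variable (𝕜 μ)

/-- The Lebesgue space `L_p`, `0 < p ≤ ∞`. -/
def Leb (p : ℝ≥0∞) : FunctionSpace 𝕜 μ :=
  .ofFinite fun f => eLpNorm f p μ

/-- The weak Lebesgue space `L_{k,∞}`, with quasi-norm `sup_{t > 0} t^(1/k) f*(t)`. -/
def WeakLeb (k : ℝ) : FunctionSpace 𝕜 μ :=
  .ofFinite fun f => ⨆ (t : ℝ) (_ : 0 < t), ENNReal.ofReal (t ^ (1 / k)) * rearr f t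

/-- The Lorentz-Karamata space of type `RL`, with its quasi-norm
`‖ t^(-1/s) c(t) ‖ u^(-1/r) b(u) ‖ v^(1/p-1/q) a(v) f*(v) ‖_{q,(u,t)} ‖_{r,(0,t)} ‖_{s,(0,∞)}`,
where `1/∞ = 0`. -/
def LorentzKaramataRL (p s : ℝ≥0∞) (c : ℝ → ℝ) (r : ℝ≥0∞) (b : ℝ → ℝ) (q : ℝ≥0∞) (a : ℝ → ℝ) :
    FunctionSpace 𝕜 μ :=
  .ofFinite fun f => normRL (p⁻¹).toReal s c r b q a (rearr f)

variable {𝕜 μ}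

/-- The Peetre `K`-functional of a couple `(A₀, A₁)`. -/
def peetreK (A₀ A₁ : FunctionSpace 𝕜 μ) (f : Ω →ₘ[μ] 𝕜) (t : ℝ) : ℝ≥0∞ :=
  ⨅ (f₀ ∈ A₀.carrier) (f₁ ∈ A₁.carrier) (_ : f = f₀ + f₁),
    A₀.qnorm f₀ + ENNReal.ofReal t * A₁.qnorm f₁

/-- The extremal interpolation space of type `RL` of a couple `(A₀, A₁)`: all `f ∈ A₀ + A₁` for
which
`‖ t^(-1/s) c(t) ‖ u^(-1/r) b(u) ‖ v^(-θ-1/q) a(v) K(v,f) ‖_{q,(u,t)} ‖_{r,(0,t)} ‖_{s,(0,∞)}`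
is finite. -/
def extremalRL (A₀ A₁ : FunctionSpace 𝕜 μ) (θ : ℝ) (s : ℝ≥0∞) (c : ℝ → ℝ) (r : ℝ≥0∞) (b : ℝ → ℝ)
    (q : ℝ≥0∞) (a : ℝ → ℝ) : FunctionSpace 𝕜 μ where
  carrier := {f | (∃ f₀ ∈ A₀.carrier, ∃ f₁ ∈ A₁.carrier, f = f₀ + f₁) ∧
    normRL (-θ) s c r b q a (peetreK A₀ A₁ f) < ∞}
  qnorm := fun f => normRL (-θ) s c r b q a (peetreK A₀ A₁ f)

end Spaces

end

end RLInterp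

namespace RLInterp

/-! ### Weighted norms -/

theorem wnorm_congr {q : ℝ≥0∞} {σ τ : ℝ} {a b : ℝ → ℝ} {I : Set ℝ} (hI : MeasurableSet I)
    {f g : ℝ → ℝ≥0∞}
    (h : ∀ u ∈ I, ENNReal.ofReal (u ^ (σ - (q⁻¹).toReal) * a u) * f u =
      ENNReal.ofReal (u ^ (τ - (q⁻¹).toReal) * b u) * g u) :
    wnorm q σ a I f = wnorm q τ b I g := by
  refine eLpNorm_congr_enorm_ae ?_
  filter_upwards [ae_restrict_mem hI] with u hu
  rw [h u hu]

theorem wnorm_mono {q : ℝ≥0∞} {σ τ : ℝ} {a b : ℝ → ℝ} {I : Set ℝ} (hI : MeasurableSet I)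
    {f g : ℝ → ℝ≥0∞}
    (h : ∀ u ∈ I, ENNReal.ofReal (u ^ (σ - (q⁻¹).toReal) * a u) * f u ≤
      ENNReal.ofReal (u ^ (τ - (q⁻¹).toReal) * b u) * g u) :
    wnorm q σ a I f ≤ wnorm q τ b I g := by
  refine eLpNorm_mono_enorm_ae ?_
  filter_upwards [ae_restrict_mem hI] with u hu
  simpa using h u hu

theorem wnorm_mono_fun {q : ℝ≥0∞} {σ : ℝ} {a : ℝ → ℝ} {I : Set ℝ} (hI : MeasurableSet I)
    {f g : ℝ → ℝ≥0∞} (h : ∀ u ∈ I, f u ≤ g u) : wnorm q σ a I f ≤ wnorm q σ a I g :=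
  wnorm_mono hI fun u hu => by gcongr; exact h u hu

theorem wnorm_mono_set {q : ℝ≥0∞} {σ : ℝ} {a : ℝ → ℝ} {I J : Set ℝ} (h : I ⊆ J)
    (f : ℝ → ℝ≥0∞) : wnorm q σ a I f ≤ wnorm q σ a J f :=
  eLpNorm_mono_measure _ (Measure.restrict_mono h le_rfl)

theorem eLpNorm_const_mul_ennreal {α : Type*} [MeasurableSpace α] {μ : Measure α} {q : ℝ≥0∞}
    {K : ℝ≥0∞} (hK : K ≠ ∞) (f : α → ℝ≥0∞) :
    eLpNorm (fun x => K * f x) q μ = K * eLpNorm f q μ := by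
  rcases eq_or_ne q 0 with rfl | h0
  · simp
  rcases eq_or_ne q ∞ with rfl | ht
  · simp [eLpNormEssSup_eq_essSup_enorm, ENNReal.essSup_const_mul]
  have hq : 0 < q.toReal := ENNReal.toReal_pos h0 ht
  simp only [eLpNorm_eq_lintegral_rpow_enorm_toReal h0 ht, enorm_eq_self,
    ENNReal.mul_rpow_of_nonneg _ _ hq.le]
  rw [lintegral_const_mul' _ _ (by finiteness), ENNReal.mul_rpow_of_nonneg _ _ (by positivity),
    ← ENNReal.rpow_mul, mul_one_div_cancel hq.ne', ENNReal.rpow_one]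

theorem wnorm_const_mul {q : ℝ≥0∞} {σ : ℝ} {a : ℝ → ℝ} {I : Set ℝ} {K : ℝ≥0∞} (hK : K ≠ ∞)
    (f : ℝ → ℝ≥0∞) : wnorm q σ a I (fun u => K * f u) = K * wnorm q σ a I f := by
  rw [wnorm, wnorm, ← eLpNorm_const_mul_ennreal hK]
  simp only [mul_left_comm]

theorem wnorm_le_const_mul {q : ℝ≥0∞} {σ : ℝ} {a : ℝ → ℝ} {I : Set ℝ} (hI : MeasurableSet I)
    {K : ℝ≥0∞} (hK : K ≠ ∞) {f g : ℝ → ℝ≥0∞} (h : ∀ u ∈ I, f u ≤ K * g u) :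
    wnorm q σ a I f ≤ K * wnorm q σ a I g :=
  (wnorm_mono_fun hI h).trans (wnorm_const_mul hK g).le

theorem wnorm_top {q : ℝ≥0∞} (hq : q ≠ 0) {σ : ℝ} {a : ℝ → ℝ} (ha : ∀ t, 0 < t → 0 < a t)
    {I : Set ℝ} (hI : MeasurableSet I) (hI0 : I ⊆ Ioi 0) (hv : volume I ≠ 0) :
    wnorm q σ a I (fun _ => ∞) = ∞ := by
  have hμ : volume.restrict I ≠ 0 := by simpa [Measure.restrict_eq_zero] using hv
  have : wnorm q σ a I (fun _ => ∞) = eLpNorm (fun _ : ℝ => (∞ : ℝ≥0∞)) q (volume.restrict I) := by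
    refine eLpNorm_congr_enorm_ae ?_
    filter_upwards [ae_restrict_mem hI] with u hu
    have hu0 : 0 < u := hI0 hu
    have hpos : 0 < u ^ (σ - (q⁻¹).toReal) * a u := mul_pos (Real.rpow_pos_of_pos hu0 _) (ha u hu0)
    rw [ENNReal.mul_top (by simpa using hpos)]
  rw [this, eLpNorm_const _ hq hμ]
  refine ENNReal.top_mul ?_
  simp only [Measure.restrict_apply_univ, ne_eq, ENNReal.rpow_eq_zero_iff, not_or, not_and_or]
  exact ⟨Or.inl hv, Or.inr (by simp)⟩

theorem essSup_restrict_image {φ : ℝ → ℝ} {I : Set ℝ} (hI : MeasurableSet I)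
    (hφI : MeasurableSet (φ '' I)) (hφ : DifferentiableOn ℝ φ I) {ψ : ℝ → ℝ}
    (hψ : DifferentiableOn ℝ ψ (φ '' I)) (hψφ : ∀ x ∈ I, ψ (φ x) = x) (F : ℝ → ℝ≥0∞) :
    essSup F (volume.restrict (φ '' I)) = essSup (fun x => F (φ x)) (volume.restrict I) := by
  have key : ∀ M, (∀ᵐ y ∂volume.restrict (φ '' I), F y ≤ M) ↔
      ∀ᵐ x ∂volume.restrict I, F (φ x) ≤ M := by
    intro M
    rw [ae_restrict_iff' hφI, ae_restrict_iff' hI, ae_iff, ae_iff]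
    have e : {y | ¬ (y ∈ φ '' I → F y ≤ M)} = φ '' {x | ¬ (x ∈ I → F (φ x) ≤ M)} := by
      ext y
      simp only [Classical.not_imp, mem_ofPred_eq, mem_image]
      constructor
      · rintro ⟨⟨x, hx, rfl⟩, h⟩
        exact ⟨x, ⟨hx, h⟩, rfl⟩
      · rintro ⟨x, ⟨hx, h⟩, rfl⟩
        exact ⟨⟨x, hx, rfl⟩, h⟩
    have hsub : {x | ¬ (x ∈ I → F (φ x) ≤ M)} ⊆ I := fun x hx => by
      simp only [Classical.not_imp, mem_ofPred_eq] at hx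
      exact hx.1
    rw [e]
    constructor
    · intro h
      have h2 := addHaar_image_eq_zero_of_differentiableOn_of_addHaar_eq_zero volume
        (hψ.mono (image_mono hsub)) h
      rw [image_image] at h2
      rwa [image_congr fun x hx => hψφ x (hsub hx), image_id'] at h2
    · exact addHaar_image_eq_zero_of_differentiableOn_of_addHaar_eq_zero volume (hφ.mono hsub)
  refine le_antisymm ?_ ?_
  · exact essSup_le_of_ae_le _ ((key _).2 (ENNReal.ae_le_essSup _))
  · exact essSup_le_of_ae_le _ ((key _).1 (ENNReal.ae_le_essSup _))

theorem eLpNorm_restrict_image {q : ℝ≥0∞} (hq : q ≠ 0) {φ φ' : ℝ → ℝ} {I : Set ℝ}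
    (hI : MeasurableSet I) (hφI : MeasurableSet (φ '' I))
    (hφ : ∀ x ∈ I, HasDerivAt φ (φ' x) x) {ψ : ℝ → ℝ}
    (hψ : DifferentiableOn ℝ ψ (φ '' I)) (hψφ : ∀ x ∈ I, ψ (φ x) = x) (F : ℝ → ℝ≥0∞) :
    eLpNorm F q (volume.restrict (φ '' I)) =
      eLpNorm (fun x => ENNReal.ofReal (|φ' x| ^ (q⁻¹).toReal) * F (φ x)) q
        (volume.restrict I) := by
  rcases eq_or_ne q ∞ with rfl | ht
  · simp only [eLpNorm_exponent_top, eLpNormEssSup_eq_essSup_enorm, enorm_eq_self]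
    rw [essSup_restrict_image hI hφI
      (fun x hx => (hφ x hx).differentiableAt.differentiableWithinAt) hψ hψφ]
    simp
  have hq0 : 0 < q.toReal := ENNReal.toReal_pos hq ht
  simp only [eLpNorm_eq_lintegral_rpow_enorm_toReal hq ht, enorm_eq_self]
  rw [lintegral_image_eq_lintegral_abs_deriv_mul hI (fun x hx => (hφ x hx).hasDerivWithinAt)
    (fun x hx y hy h => by rw [← hψφ x hx, ← hψφ y hy, h])]
  simp only [ENNReal.mul_rpow_of_nonneg _ _ hq0.le,
    ENNReal.ofReal_rpow_of_nonneg (Real.rpow_nonneg (abs_nonneg _) _) hq0.le, ENNReal.toReal_inv,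
    ← Real.rpow_mul (abs_nonneg _), inv_mul_cancel₀ hq0.ne', Real.rpow_one]

theorem rpow_substitution {lam κ x : ℝ} (hl : 0 < lam) (hκ : 0 < κ) (hx : 0 < x) (σ i : ℝ) :
    |lam * (κ * x ^ (κ - 1))| ^ i * (lam * x ^ κ) ^ (σ - i) =
      κ ^ i * lam ^ σ * x ^ (σ * κ - i) := by
  have h1 : 0 < x ^ (κ - 1) := Real.rpow_pos_of_pos hx _
  have h2 : 0 < x ^ κ := Real.rpow_pos_of_pos hx _
  have h3 : x ^ (σ * κ - i) = x ^ ((κ - 1) * i) * x ^ (κ * (σ - i)) := by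
    rw [← Real.rpow_add hx]; ring_nf
  have h4 : lam ^ σ = lam ^ i * lam ^ (σ - i) := by
    rw [← Real.rpow_add hl]; ring_nf
  rw [abs_of_pos (by positivity), Real.mul_rpow hl.le (by positivity),
    Real.mul_rpow hκ.le h1.le, Real.mul_rpow hl.le h2.le, ← Real.rpow_mul hx.le,
    ← Real.rpow_mul hx.le, h3, h4]
  ring

/-- Change of variables `u = lam * x ^ κ` in a weighted norm. -/
theorem wnorm_image {q : ℝ≥0∞} (hq : q ≠ 0) {lam κ : ℝ} (hl : 0 < lam) (hκ : 0 < κ) (σ : ℝ)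
    (b : ℝ → ℝ) {I J : Set ℝ} (hI : MeasurableSet I) (hI0 : I ⊆ Ioi 0) (hJ : MeasurableSet J)
    (hIJ : (fun x => lam * x ^ κ) '' I = J) (g : ℝ → ℝ≥0∞) :
    wnorm q σ b J g = ENNReal.ofReal (κ ^ (q⁻¹).toReal * lam ^ σ) *
      wnorm q (σ * κ) (fun x => b (lam * x ^ κ)) I (fun x => g (lam * x ^ κ)) := by
  subst hIJ
  have hd : ∀ x ∈ I, HasDerivAt (fun x => lam * x ^ κ) (lam * (κ * x ^ (κ - 1))) x :=
    fun x hx => (Real.hasDerivAt_rpow_const (Or.inl (hI0 hx).ne')).const_mul lam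
  have hψ : DifferentiableOn ℝ (fun y : ℝ => (lam⁻¹ * y) ^ (κ⁻¹)) ((fun x => lam * x ^ κ) '' I) := by
    rintro y ⟨x, hx, rfl⟩
    have hx0 : 0 < x := hI0 hx
    have : lam⁻¹ * (lam * x ^ κ) ≠ 0 := by positivity
    exact ((hasDerivAt_id' _).const_mul lam⁻¹).differentiableAt.rpow_const (Or.inl this)
      |>.differentiableWithinAt
  have hψφ : ∀ x ∈ I, (lam⁻¹ * (lam * x ^ κ)) ^ (κ⁻¹) = x := by
    intro x hx
    rw [inv_mul_cancel_left₀ hl.ne', ← Real.rpow_mul (hI0 hx).le, mul_inv_cancel₀ hκ.ne',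
      Real.rpow_one]
  rw [wnorm, eLpNorm_restrict_image hq hI hJ hd hψ hψφ, wnorm,
    ← eLpNorm_const_mul_ennreal ENNReal.ofReal_ne_top]
  refine eLpNorm_congr_enorm_ae ?_
  filter_upwards [ae_restrict_mem hI] with x hx
  have hx0 : 0 < x := hI0 hx
  rw [← mul_assoc (ENNReal.ofReal _), ← mul_assoc (ENNReal.ofReal _),
    ← ENNReal.ofReal_mul (by positivity), ← ENNReal.ofReal_mul (by positivity),
    ← mul_assoc (_ ^ _), ← mul_assoc (_ * _), rpow_substitution hl hκ hx0]

theorem SlowlyVarying.exists_le_rpow_mul {b : ℝ → ℝ} (hb : SlowlyVarying b) {ε : ℝ} (hε : 0 < ε) :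
    ∃ C : ℝ, 0 < C ∧ ∀ lam t : ℝ, 0 < lam → lam ≤ 1 → 0 < t →
      b t ≤ C * lam ^ (-ε) * b (lam * t) := by
  obtain ⟨g, hg, C, hC, h⟩ := hb.equiv_decreasing ε hε
  refine ⟨C * C, by positivity, fun lam t hl hl1 ht => ?_⟩
  have hlt : 0 < lam * t := by positivity
  have h1 := (h t ht).1
  have h2 : g t ≤ g (lam * t) := hg hlt ht (by nlinarith)
  have h3 := (h _ hlt).2
  have h4 : t ^ (-ε) * b t ≤ C * (C * ((lam * t) ^ (-ε) * b (lam * t))) :=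
    h1.trans (by gcongr; exact h2.trans h3)
  rw [Real.mul_rpow hl.le ht.le] at h4
  have h5 : 0 < t ^ (-ε) := Real.rpow_pos_of_pos ht _
  refine le_of_mul_le_mul_left (h4.trans (le_of_eq ?_)) h5
  ring

/-- Dilation estimate for weighted norms with a slowly varying weight. -/
theorem SlowlyVarying.exists_wnorm_dilation_le {b : ℝ → ℝ} (hb : SlowlyVarying b) {q : ℝ≥0∞}
    (hq : q ≠ 0) (σ : ℝ) {ε : ℝ} (hε : 0 < ε) :
    ∃ C : ℝ, 0 < C ∧ ∀ lam : ℝ, 0 < lam → lam ≤ 1 → ∀ u t : ℝ, 0 ≤ u → ∀ g : ℝ → ℝ≥0∞,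
      wnorm q σ b (Ioo u t) (fun v => g (lam * v)) ≤
        ENNReal.ofReal (C * lam ^ (-ε - σ)) * wnorm q σ b (Ioo (lam * u) (lam * t)) g := by
  obtain ⟨C, hC, h⟩ := hb.exists_le_rpow_mul hε
  refine ⟨C, hC, fun lam hl hl1 u t hu g => ?_⟩
  have hI0 : Ioo u t ⊆ Ioi 0 := fun x hx => hu.trans_lt hx.1
  have himg : (fun x : ℝ => lam * x ^ (1 : ℝ)) '' Ioo u t = Ioo (lam * u) (lam * t) := by
    simp only [Real.rpow_one]
    exact image_mul_left_Ioo hl _ _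
  rw [wnorm_image hq hl one_pos σ b measurableSet_Ioo hI0 measurableSet_Ioo himg g, ← mul_assoc,
    ← ENNReal.ofReal_mul (by positivity)]
  simp only [Real.one_rpow, one_mul, mul_one, Real.rpow_one]
  rw [mul_assoc, ← Real.rpow_add hl, sub_add_cancel, ← wnorm_const_mul ENNReal.ofReal_ne_top]
  refine wnorm_mono measurableSet_Ioo fun v hv => ?_
  have hv0 : 0 < v := hI0 hv
  rw [← mul_assoc, ← ENNReal.ofReal_mul (mul_nonneg (Real.rpow_nonneg hv0.le _)
    (hb.pos _ (by positivity)).le)]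
  gcongr ENNReal.ofReal ?_ * _
  rw [mul_assoc, mul_comm (b (lam * v))]
  gcongr
  exact h lam v hl hl1 hv0

/-! ### Suprema of dyadic families -/

theorem exists_tsum_rpow_le {q δ : ℝ} (hq : 0 < q) (hδ : 0 < δ) :
    ∃ C : ℝ, 0 < C ∧ ∀ x : ℕ → ℝ≥0∞, (∑' j, x j ^ q) ^ (1 / q) ≤
      ENNReal.ofReal C * ⨆ j : ℕ, ENNReal.ofReal (((1 / 2 : ℝ) ^ j) ^ (-δ)) * x j := by
  set ρ : ℝ≥0∞ := ENNReal.ofReal ((1 / 2 : ℝ) ^ (δ * q)) with hρ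
  have hρ1 : ρ < 1 := by
    rw [hρ, ENNReal.ofReal_lt_one]
    exact Real.rpow_lt_one (by norm_num) (by norm_num) (by positivity)
  have hC0 : (1 - ρ)⁻¹ ≠ ∞ := ENNReal.inv_ne_top.2 (tsub_pos_of_lt hρ1).ne'
  have hC0' : (1 - ρ)⁻¹ ≠ 0 := ENNReal.inv_ne_zero.2 (by finiteness)
  have hC1 : ((1 - ρ)⁻¹) ^ (1 / q) ≠ ∞ := by finiteness
  have hC1' : ((1 - ρ)⁻¹) ^ (1 / q) ≠ 0 := by
    simp only [ne_eq, ENNReal.rpow_eq_zero_iff, not_or, not_and_or]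
    exact ⟨Or.inl hC0', Or.inl hC0⟩
  refine ⟨(((1 - ρ)⁻¹) ^ (1 / q)).toReal, ENNReal.toReal_pos hC1' hC1, fun x => ?_⟩
  rw [ENNReal.ofReal_toReal hC1]
  set S := ⨆ j : ℕ, ENNReal.ofReal (((1 / 2 : ℝ) ^ j) ^ (-δ)) * x j with hS
  have hx : ∀ j, x j ^ q ≤ ρ ^ j * S ^ q := by
    intro j
    have hj : (0 : ℝ) < (1 / 2 : ℝ) ^ j := by positivity
    have h1 : ENNReal.ofReal (((1 / 2 : ℝ) ^ j) ^ (-δ)) * x j ≤ S :=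
      le_iSup (fun j : ℕ => ENNReal.ofReal (((1 / 2 : ℝ) ^ j) ^ (-δ)) * x j) j
    have h2 : x j ≤ ENNReal.ofReal (((1 / 2 : ℝ) ^ j) ^ δ) * S := by
      calc x j = ENNReal.ofReal (((1 / 2 : ℝ) ^ j) ^ δ) *
            (ENNReal.ofReal (((1 / 2 : ℝ) ^ j) ^ (-δ)) * x j) := by
            rw [← mul_assoc, ← ENNReal.ofReal_mul (by positivity), ← Real.rpow_add hj]
            simp
        _ ≤ _ := by gcongr
    calc x j ^ q ≤ (ENNReal.ofReal (((1 / 2 : ℝ) ^ j) ^ δ) * S) ^ q := by gcongr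
      _ = ρ ^ j * S ^ q := by
        rw [ENNReal.mul_rpow_of_nonneg _ _ hq.le, ENNReal.ofReal_rpow_of_pos (by positivity), hρ,
          ← ENNReal.ofReal_pow (by positivity), ← Real.rpow_mul hj.le, ← Real.rpow_natCast,
          ← Real.rpow_natCast, ← Real.rpow_mul (by norm_num), ← Real.rpow_mul (by norm_num),
          mul_comm (j : ℝ)]
  calc (∑' j, x j ^ q) ^ (1 / q) ≤ (∑' j, ρ ^ j * S ^ q) ^ (1 / q) := by
        gcongr with j
        exact hx j
    _ = _ := by
        rw [ENNReal.tsum_mul_right, ENNReal.tsum_geometric,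
          ENNReal.mul_rpow_of_nonneg _ _ (by positivity), ← ENNReal.rpow_mul,
          mul_one_div_cancel hq.ne', ENNReal.rpow_one]

theorem iSup_rpow_le_tsum {q : ℝ} (hq : 0 < q) (x : ℕ → ℝ≥0∞) :
    (⨆ j, x j) ^ q ≤ ∑' j, x j ^ q := by
  rw [← ENNReal.le_rpow_inv_iff hq]
  refine iSup_le fun j => ?_
  rw [ENNReal.le_rpow_inv_iff hq]
  exact ENNReal.le_tsum j

theorem one_le_dyadic_rpow_neg {δ : ℝ} (hδ : 0 ≤ δ) (j : ℕ) :
    1 ≤ ENNReal.ofReal (((1 / 2 : ℝ) ^ j) ^ (-δ)) := by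
  rw [ENNReal.one_le_ofReal]
  exact Real.one_le_rpow_of_pos_of_le_one_of_nonpos (by positivity)
    (pow_le_one₀ (by norm_num) (by norm_num)) (by linarith)

theorem exists_eLpNorm_iSup_le {q : ℝ≥0∞} (hq : q ≠ 0) {δ : ℝ} (hδ : 0 < δ) :
    ∃ C : ℝ, 0 < C ∧ ∀ (μ : Measure ℝ) (f : ℕ → ℝ → ℝ≥0∞), (∀ j, AEMeasurable (f j) μ) →
      eLpNorm (fun x => ⨆ j, f j x) q μ ≤
        ENNReal.ofReal C * ⨆ j : ℕ, ENNReal.ofReal (((1 / 2 : ℝ) ^ j) ^ (-δ)) *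
          eLpNorm (f j) q μ := by
  rcases eq_or_ne q ∞ with rfl | ht
  · refine ⟨1, one_pos, fun μ f _ => ?_⟩
    simp only [eLpNorm_exponent_top, eLpNormEssSup_eq_essSup_enorm, enorm_eq_self,
      ENNReal.ofReal_one, one_mul]
    refine essSup_le_of_ae_le _ ?_
    filter_upwards [ae_all_iff.2 fun j => ENNReal.ae_le_essSup (μ := μ) (f j)] with x hx
    refine iSup_mono fun j => (hx j).trans ?_
    exact le_mul_of_one_le_left' (one_le_dyadic_rpow_neg hδ.le j)
  have hq0 : 0 < q.toReal := ENNReal.toReal_pos hq ht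
  obtain ⟨C, hC, h⟩ := exists_tsum_rpow_le hq0 hδ
  refine ⟨C, hC, fun μ f hf => ?_⟩
  refine le_trans ?_ (h _)
  simp only [eLpNorm_eq_lintegral_rpow_enorm_toReal hq ht, enorm_eq_self, ← ENNReal.rpow_mul,
    one_div_mul_cancel hq0.ne', ENNReal.rpow_one]
  rw [← lintegral_tsum fun j => (hf j).pow_const _]
  gcongr with x
  exact iSup_rpow_le_tsum hq0 _

theorem SlowlyVarying.exists_wnorm_iSup_le {b : ℝ → ℝ} (hb : SlowlyVarying b) {q : ℝ≥0∞}
    (hq : q ≠ 0) (σ : ℝ) {δ : ℝ} (hδ : 0 < δ) :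
    ∃ C : ℝ, 0 < C ∧ ∀ I : Set ℝ, I ⊆ Ioi 0 → ∀ f : ℕ → ℝ → ℝ≥0∞, (∀ j, Measurable (f j)) →
      wnorm q σ b I (fun x => ⨆ j, f j x) ≤
        ENNReal.ofReal C * ⨆ j : ℕ, ENNReal.ofReal (((1 / 2 : ℝ) ^ j) ^ (-δ)) *
          wnorm q σ b I (f j) := by
  obtain ⟨C, hC, h⟩ := exists_eLpNorm_iSup_le hq hδ
  refine ⟨C, hC, fun I hI f hf => ?_⟩
  have hbI : AEMeasurable b (volume.restrict I) :=
    hb.measurable.mono_measure (Measure.restrict_mono hI le_rfl)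
  have := h (volume.restrict I)
    (fun j u => ENNReal.ofReal (u ^ (σ - (q⁻¹).toReal) * b u) * f j u) fun j =>
      (((measurable_id.pow_const _).aemeasurable.mul hbI).ennreal_ofReal).mul (hf j).aemeasurable
  simpa only [wnorm, ENNReal.mul_iSup] using this

/-! ### Rearrangements and `K`-functionals -/

section Rearrangement

variable {Ω : Type*} [MeasurableSpace Ω] {μ : Measure Ω} {𝕜 : Type*} [RCLike 𝕜]

theorem rearr_antitone (f : Ω →ₘ[μ] 𝕜) : Antitone (rearr f) := fun _ _ h =>
  sInf_le_sInf fun _ hl => le_trans hl (ENNReal.ofReal_le_ofReal h)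

theorem measure_rearr_lt_le (f : Ω →ₘ[μ] 𝕜) (t : ℝ) :
    μ {x | rearr f t < ‖f x‖ₑ} ≤ ENNReal.ofReal t := by
  rcases eq_or_ne (rearr f t) ∞ with h | h
  · simp [h]
  obtain ⟨u, hu, hlt, hlim⟩ := exists_seq_strictAnti_tendsto' (lt_top_iff_ne_top.2 h)
  have hset : {x | rearr f t < ‖f x‖ₑ} = ⋃ n, {x | u n < ‖f x‖ₑ} := by
    ext x
    simp only [mem_ofPred_eq, mem_iUnion]
    exact ⟨fun hx => (hlim.eventually_lt_const hx).exists, fun ⟨n, hn⟩ => (hlt n).1.trans hn⟩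
  have hmono : Monotone fun n => {x | u n < ‖f x‖ₑ} := fun m n hmn x hx =>
    (hu.antitone hmn).trans_lt hx
  rw [hset, hmono.measure_iUnion]
  refine iSup_le fun n => ?_
  obtain ⟨l, hl, hln⟩ := sInf_lt_iff.1 (hlt n).1
  exact (measure_mono fun x (hx : u n < ‖f x‖ₑ) => hln.trans hx).trans hl

theorem rearr_add_le (f g : Ω →ₘ[μ] 𝕜) (t : ℝ) :
    rearr (f + g) t ≤ rearr f t + eLpNorm g ∞ μ := by
  refine sInf_le (le_trans (measure_mono_ae ?_) (measure_rearr_lt_le f t))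
  rw [eLpNorm_exponent_top]
  filter_upwards [AEEqFun.coeFn_add f g, ae_le_eLpNormEssSup (f := g) (μ := μ)] with x hx hg
  intro (h : _ < _)
  rw [hx, Pi.add_apply] at h
  by_contra h'
  exact absurd h (not_lt.2 ((enorm_add_le _ _).trans (add_le_add (not_lt.1 h') hg)))

theorem ofReal_rpow_mul_rearr_le {κ : ℝ} (hκ : 0 < κ) (f : Ω →ₘ[μ] 𝕜) {t : ℝ} (ht : 0 < t) :
    ENNReal.ofReal (t ^ (1 / κ)) * rearr f t ≤ eLpNorm f (ENNReal.ofReal κ) μ := by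
  set M := eLpNorm f (ENNReal.ofReal κ) μ with hM
  have hκ0 : ENNReal.ofReal κ ≠ 0 := by simpa using hκ
  have hT : 0 < t ^ (1 / κ) := Real.rpow_pos_of_pos ht _
  rw [mul_comm, ← ENNReal.le_div_iff_mul_le (Or.inl (by simpa using hT))
    (Or.inl ENNReal.ofReal_ne_top)]
  set l := M / ENNReal.ofReal (t ^ (1 / κ)) with hl
  refine sInf_le (show μ {x | l < ‖f x‖ₑ} ≤ _ from ?_)
  rcases eq_or_ne M 0 with h0 | h0
  · rw [hM, eLpNorm_eq_zero_iff f.aestronglyMeasurable hκ0] at h0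
    have : μ {x | l < ‖f x‖ₑ} = 0 := by
      rw [measure_eq_zero_iff_ae_notMem]
      filter_upwards [h0] with x hx
      simp [hx]
    simp [this]
  rcases eq_or_ne M ∞ with h1 | h1
  · have : l = ∞ := by rw [hl, h1, ENNReal.top_div_of_ne_top ENNReal.ofReal_ne_top]
    simp [this]
  have h2 := mul_meas_ge_le_pow_eLpNorm' μ hκ0 ENNReal.ofReal_ne_top f.aestronglyMeasurable l
  rw [ENNReal.toReal_ofReal hκ.le, ← hM] at h2
  have h3 : M ^ κ = l ^ κ * ENNReal.ofReal t := by
    rw [hl, ENNReal.div_rpow_of_nonneg _ _ hκ.le, ENNReal.ofReal_rpow_of_pos hT,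
      ← Real.rpow_mul ht.le, one_div_mul_cancel hκ.ne', Real.rpow_one,
      ENNReal.div_mul_cancel (by simpa using ht) ENNReal.ofReal_ne_top]
  rw [h3] at h2
  have hl0 : l ≠ 0 := ENNReal.div_ne_zero.2 ⟨h0, ENNReal.ofReal_ne_top⟩
  have hl1 : l ≠ ∞ := ENNReal.div_ne_top h1 (by simpa using hT)
  have hlκ : l ^ κ ≠ 0 := by
    simp only [ne_eq, ENNReal.rpow_eq_zero_iff, not_or, not_and_or]
    exact ⟨Or.inl hl0, Or.inl hl1⟩
  rw [ENNReal.mul_le_mul_iff_right hlκ (by finiteness)] at h2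
  exact (measure_mono fun x (hx : l < _) => hx.le).trans h2

/-- The function `t ↦ t f*(t^κ)`. -/
noncomputable def powRearr (κ : ℝ) (f : Ω →ₘ[μ] 𝕜) (t : ℝ) : ℝ≥0∞ :=
  ENNReal.ofReal t * rearr f (t ^ κ)

theorem measurable_powRearr (κ : ℝ) (f : Ω →ₘ[μ] 𝕜) : Measurable (powRearr κ f) :=
  ENNReal.measurable_ofReal.mul
    ((rearr_antitone f).measurable.comp (measurable_id.pow_const κ))

theorem powRearr_le_peetreK {κ : ℝ} (hκ : 0 < κ) (f : Ω →ₘ[μ] 𝕜) {t : ℝ} (ht : 0 < t) :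
    powRearr κ f t ≤ peetreK (WeakLeb 𝕜 μ κ) (Leb 𝕜 μ ∞) f t := by
  refine le_iInf₂ fun f₀ _ => le_iInf₂ fun f₁ _ => le_iInf fun hf => ?_
  rw [hf, powRearr]
  refine (mul_le_mul_right (rearr_add_le f₀ f₁ _) _).trans ?_
  rw [mul_add]
  refine add_le_add ?_ le_rfl
  refine le_trans (le_of_eq ?_) (le_iSup₂_of_le (t ^ κ) (Real.rpow_pos_of_pos ht κ) le_rfl)
  rw [← Real.rpow_mul ht.le, mul_one_div_cancel hκ.ne', Real.rpow_one]

theorem weakLeb_qnorm_le {κ : ℝ} (hκ : 0 < κ) (f : Ω →ₘ[μ] 𝕜) :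
    (WeakLeb 𝕜 μ κ).qnorm f ≤ (Leb 𝕜 μ (ENNReal.ofReal κ)).qnorm f :=
  iSup₂_le fun _ ht => ofReal_rpow_mul_rearr_le hκ f ht

theorem leb_carrier_subset_weakLeb {κ : ℝ} (hκ : 0 < κ) :
    (Leb 𝕜 μ (ENNReal.ofReal κ)).carrier ⊆ (WeakLeb 𝕜 μ κ).carrier := fun f hf =>
  (weakLeb_qnorm_le hκ f).trans_lt hf

theorem peetreK_weakLeb_le {κ : ℝ} (hκ : 0 < κ) (f : Ω →ₘ[μ] 𝕜) (t : ℝ) :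
    peetreK (WeakLeb 𝕜 μ κ) (Leb 𝕜 μ ∞) f t ≤
      peetreK (Leb 𝕜 μ (ENNReal.ofReal κ)) (Leb 𝕜 μ ∞) f t := by
  refine le_iInf₂ fun f₀ h₀ => le_iInf₂ fun f₁ h₁ => le_iInf fun hf => ?_
  refine (iInf₂_le f₀ (leb_carrier_subset_weakLeb hκ h₀)).trans <|
    (iInf₂_le f₁ h₁).trans <| (iInf_le _ hf).trans ?_
  gcongr
  exact weakLeb_qnorm_le hκ f₀

/-- Dyadic layers: the `L_κ` norm of the part of `f` above the level `f*(t^κ)`. -/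
theorem lintegral_indicator_rearr_lt_le {κ : ℝ} (hκ : 0 < κ) (f : Ω →ₘ[μ] 𝕜) {t : ℝ} (ht : 0 < t) :
    ∫⁻ x, ‖{x | rearr f (t ^ κ) < ‖f x‖ₑ}.indicator f x‖ₑ ^ κ ∂μ ≤
      ∑' j : ℕ, (2 * powRearr κ f ((1 / 2) ^ (j + 1) * t)) ^ κ := by
  set lv : ℕ → ℝ≥0∞ := fun j => rearr f (((1 / 2) ^ j * t) ^ κ) with hlv
  set E : ℕ → Set Ω := fun j => {x | lv j < ‖f x‖ₑ} with hE
  have hEm : ∀ j, MeasurableSet (E j) := fun j =>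
    measurableSet_lt measurable_const f.stronglyMeasurable.measurable.enorm
  have hμE : ∀ j, μ (E j) ≤ ENNReal.ofReal ((1 / 2) ^ j * t) ^ κ := fun j => by
    rw [ENNReal.ofReal_rpow_of_pos (by positivity)]
    exact measure_rearr_lt_le f _
  have hnull : μ (⋂ j, E j) = 0 := by
    have hlim : Filter.Tendsto (fun j : ℕ => ENNReal.ofReal ((1 / 2) ^ j * t) ^ κ) Filter.atTop
        (nhds 0) := by
      have h1 : Filter.Tendsto (fun j : ℕ => (1 / 2 : ℝ) ^ j * t) Filter.atTop (nhds 0) := by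
        simpa using (tendsto_pow_atTop_nhds_zero_of_lt_one (r := (1 / 2 : ℝ)) (by norm_num)
          (by norm_num)).mul_const t
      have h2 := ((ENNReal.continuous_rpow_const (y := κ)).tendsto _).comp
        ((ENNReal.continuous_ofReal.tendsto _).comp h1)
      rw [ENNReal.ofReal_zero, ENNReal.zero_rpow_of_pos hκ] at h2
      exact h2
    exact le_antisymm (ge_of_tendsto' hlim fun j =>
      (measure_mono (iInter_subset E j)).trans (hμE j)) zero_le
  have hpt : ∀ᵐ x ∂μ, ‖{x | rearr f (t ^ κ) < ‖f x‖ₑ}.indicator f x‖ₑ ^ κ ≤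
      ∑' j : ℕ, (E j).indicator (fun _ => lv (j + 1) ^ κ) x := by
    filter_upwards [measure_eq_zero_iff_ae_notMem.1 hnull] with x hx
    by_cases hx0 : x ∈ {x | rearr f (t ^ κ) < ‖f x‖ₑ}
    · classical
      have hex : ∃ j, x ∉ E j := by simpa using hx
      obtain ⟨m, hm⟩ : ∃ m, Nat.find hex = m + 1 := by
        refine Nat.exists_eq_succ_of_ne_zero fun h => ?_
        have := Nat.find_spec hex
        rw [h] at this
        exact this (by simpa [hE, hlv] using hx0)
      have h1 : x ∈ E m := not_not.1 (Nat.find_min hex (by omega))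
      have h2 : ‖f x‖ₑ ≤ lv (m + 1) := by
        have := Nat.find_spec hex
        rw [hm] at this
        exact not_lt.1 this
      rw [indicator_of_mem hx0]
      refine le_trans ?_ (ENNReal.le_tsum m)
      rw [indicator_of_mem h1]
      gcongr
    · rw [indicator_of_notMem hx0]
      simp [hκ]
  refine (lintegral_mono_ae hpt).trans ?_
  rw [lintegral_tsum fun j => (measurable_const.indicator (hEm j)).aemeasurable]
  gcongr with j
  rw [lintegral_indicator_const (hEm j)]
  refine (mul_le_mul_right (hμE j) _).trans (le_of_eq ?_)
  rw [← ENNReal.mul_rpow_of_nonneg _ _ hκ.le, powRearr, ← mul_assoc, mul_comm]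
  congr 2
  rw [show (2 : ℝ≥0∞) = ENNReal.ofReal 2 by simp, ← ENNReal.ofReal_mul (by norm_num)]
  congr 1
  ring

theorem exists_peetreK_leb_le {κ ε : ℝ} (hκ : 0 < κ) (hε : 0 < ε) :
    ∃ C : ℝ, 0 < C ∧ ∀ (f : Ω →ₘ[μ] 𝕜) (t : ℝ), 0 < t →
      peetreK (Leb 𝕜 μ (ENNReal.ofReal κ)) (Leb 𝕜 μ ∞) f t ≤
        ENNReal.ofReal C * ⨆ j : ℕ, ENNReal.ofReal (((1 / 2 : ℝ) ^ j) ^ (-ε)) *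
          powRearr κ f ((1 / 2) ^ j * t) := by
  obtain ⟨C, hC, h⟩ := exists_tsum_rpow_le hκ hε
  refine ⟨C * 2 + 1, by positivity, fun f t ht => ?_⟩
  set S := ⨆ j : ℕ, ENNReal.ofReal (((1 / 2 : ℝ) ^ j) ^ (-ε)) * powRearr κ f ((1 / 2) ^ j * t)
    with hS
  rcases eq_or_ne S ∞ with hST | hST
  · rw [hST, ENNReal.mul_top (by simpa using by positivity)]
    exact le_top
  have hSj : ∀ j : ℕ, ENNReal.ofReal (((1 / 2 : ℝ) ^ j) ^ (-ε)) * powRearr κ f ((1 / 2) ^ j * t)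
      ≤ S := le_iSup (fun j : ℕ => ENNReal.ofReal (((1 / 2 : ℝ) ^ j) ^ (-ε)) *
        powRearr κ f ((1 / 2) ^ j * t))
  set L := rearr f (t ^ κ) with hL
  have hLS : ENNReal.ofReal t * L ≤ S := by simpa [powRearr] using hSj 0
  have hLT : L ≠ ∞ := by
    intro hLT
    rw [hLT, ENNReal.mul_top (by simpa using ht)] at hLS
    exact hST (top_le_iff.1 hLS)
  set E : Set Ω := {x | L < ‖f x‖ₑ} with hE
  have hEm : MeasurableSet E :=
    measurableSet_lt measurable_const f.stronglyMeasurable.measurable.enorm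
  have hm0 : AEStronglyMeasurable (E.indicator f) μ := f.aestronglyMeasurable.indicator hEm
  have hm1 : AEStronglyMeasurable (Eᶜ.indicator f) μ := f.aestronglyMeasurable.indicator hEm.compl
  have hκ0 : ENNReal.ofReal κ ≠ 0 := by simpa using hκ
  have hn0 : eLpNorm (AEEqFun.mk _ hm0) (ENNReal.ofReal κ) μ ≤ ENNReal.ofReal (C * 2) * S := by
    rw [eLpNorm_congr_ae (AEEqFun.coeFn_mk _ hm0),
      eLpNorm_eq_lintegral_rpow_enorm_toReal hκ0 ENNReal.ofReal_ne_top,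
      ENNReal.toReal_ofReal hκ.le]
    calc _ ≤ (∑' j : ℕ, (2 * powRearr κ f ((1 / 2) ^ (j + 1) * t)) ^ κ) ^ (1 / κ) := by
          gcongr
          exact lintegral_indicator_rearr_lt_le hκ f ht
      _ ≤ _ := h _
      _ ≤ ENNReal.ofReal C * (2 * S) := by
          gcongr
          refine iSup_le fun j => ?_
          rw [mul_left_comm]
          gcongr
          refine le_trans ?_ (hSj (j + 1))
          gcongr ENNReal.ofReal ?_ * _
          refine Real.rpow_le_rpow_of_nonpos (by positivity) ?_ (by linarith)
          exact pow_le_pow_of_le_one (by norm_num) (by norm_num) (Nat.le_succ j)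
      _ = _ := by
          rw [ENNReal.ofReal_mul hC.le, mul_assoc]
          simp
  have hn1 : eLpNorm (AEEqFun.mk _ hm1) ∞ μ ≤ L := by
    rw [eLpNorm_congr_ae (AEEqFun.coeFn_mk _ hm1), eLpNorm_exponent_top,
      eLpNormEssSup_eq_essSup_enorm]
    refine essSup_le_of_ae_le _ (Filter.Eventually.of_forall fun x => ?_)
    by_cases hx : x ∈ E
    · simp [hx]
    · simpa [hx] using not_lt.1 hx
  have hsum : f = AEEqFun.mk _ hm0 + AEEqFun.mk _ hm1 := by
    refine AEEqFun.ext ?_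
    filter_upwards [AEEqFun.coeFn_add (AEEqFun.mk _ hm0) (AEEqFun.mk _ hm1),
      AEEqFun.coeFn_mk _ hm0, AEEqFun.coeFn_mk _ hm1] with x hx h0 h1
    rw [hx, Pi.add_apply, h0, h1, indicator_self_add_compl_apply]
  have hc0 : AEEqFun.mk _ hm0 ∈ (Leb 𝕜 μ (ENNReal.ofReal κ)).carrier :=
    hn0.trans_lt (by finiteness)
  have hc1 : AEEqFun.mk _ hm1 ∈ (Leb 𝕜 μ ∞).carrier := hn1.trans_lt (by finiteness)
  refine (iInf₂_le _ hc0).trans <| (iInf₂_le _ hc1).trans <| (iInf_le _ hsum).trans ?_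
  calc _ ≤ ENNReal.ofReal (C * 2) * S + S :=
        add_le_add hn0 ((mul_le_mul_right hn1 _).trans hLS)
    _ = _ := by
        rw [ENNReal.ofReal_add (by positivity) zero_le_one, add_mul, ENNReal.ofReal_one, one_mul]

end Rearrangement

/-! ### Comparison of the iterated norms -/

theorem normRL_mono {σ : ℝ} {q r s : ℝ≥0∞} {a b c : ℝ → ℝ} {g h : ℝ → ℝ≥0∞}
    (hgh : ∀ t, 0 < t → g t ≤ h t) : normRL σ s c r b q a g ≤ normRL σ s c r b q a h :=
  wnorm_mono_fun measurableSet_Ioi fun _ _ => wnorm_mono_fun measurableSet_Ioo fun _ hu =>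
    wnorm_mono_fun measurableSet_Ioo fun _ hv => hgh _ (hu.1.trans hv.1)

theorem normRL_const_mul {σ : ℝ} {q r s : ℝ≥0∞} {a b c : ℝ → ℝ} {K : ℝ≥0∞} (hK : K ≠ ∞)
    (g : ℝ → ℝ≥0∞) :
    normRL σ s c r b q a (fun t => K * g t) = K * normRL σ s c r b q a g := by
  simp only [normRL, wnorm_const_mul hK]

theorem normRL_top {σ : ℝ} {q r s : ℝ≥0∞} (hq : q ≠ 0) (hr : r ≠ 0) (hs : s ≠ 0)
    {a b c : ℝ → ℝ} (ha : SlowlyVarying a) (hb : SlowlyVarying b) (hc : SlowlyVarying c) :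
    normRL σ s c r b q a (fun _ => ∞) = ∞ := by
  refine top_le_iff.1 ((wnorm_top hs (σ := 0) hc.pos measurableSet_Ioi subset_rfl
    (by simp)).ge.trans (wnorm_mono_fun measurableSet_Ioi fun t (ht : 0 < t) => ?_))
  refine (wnorm_top hr (σ := 0) hb.pos measurableSet_Ioo Ioo_subset_Ioi_self
    (by simpa using ht)).ge.trans (wnorm_mono_fun measurableSet_Ioo fun u hu => ?_)
  exact (wnorm_top hq ha.pos measurableSet_Ioo (fun v hv => hu.1.trans hv.1)
    (by simpa using hu.2)).ge

theorem exists_wnorm_wnorm_iSup_dilation_le {θ : ℝ} (hθ : 0 < θ) {q r : ℝ≥0∞} (hq : q ≠ 0)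
    (hr : r ≠ 0) {a b : ℝ → ℝ} (ha : SlowlyVarying a) (hb : SlowlyVarying b) :
    ∃ C : ℝ, 0 < C ∧ ∀ h : ℝ → ℝ≥0∞, Measurable h → ∀ t : ℝ,
      wnorm r 0 b (Ioo 0 t) (fun u => wnorm q (-θ) a (Ioo u t) fun v =>
        ⨆ j : ℕ, ENNReal.ofReal (((1 / 2 : ℝ) ^ j) ^ (-(θ / 5))) * h ((1 / 2) ^ j * v)) ≤
      ENNReal.ofReal C * wnorm r 0 b (Ioo 0 t) fun u => wnorm q (-θ) a (Ioo u t) h := by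
  have hε : 0 < θ / 5 := by positivity
  obtain ⟨C₁, hC₁, h₁⟩ := ha.exists_wnorm_iSup_le hq (-θ) hε
  obtain ⟨C₂, hC₂, h₂⟩ := ha.exists_wnorm_dilation_le hq (-θ) hε
  obtain ⟨C₃, hC₃, h₃⟩ := hb.exists_wnorm_iSup_le hr 0 hε
  obtain ⟨C₄, hC₄, h₄⟩ := hb.exists_wnorm_dilation_le hr 0 hε
  refine ⟨C₁ * (C₃ * (C₂ * C₄)), by positivity, fun h hh t => ?_⟩
  have hpos : ∀ j : ℕ, (0 : ℝ) < (1 / 2) ^ j := fun j => by positivity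
  have hle : ∀ j : ℕ, (1 / 2 : ℝ) ^ j ≤ 1 := fun j => pow_le_one₀ (by norm_num) (by norm_num)
  set H : ℝ → ℝ≥0∞ := fun u => wnorm q (-θ) a (Ioo u t) h with hH
  have hHm : Measurable H := Antitone.measurable fun u v huv =>
    wnorm_mono_set (Ioo_subset_Ioo_left huv) h
  have inner : ∀ u ∈ Ioo 0 t, (wnorm q (-θ) a (Ioo u t) fun v => ⨆ j : ℕ,
      ENNReal.ofReal (((1 / 2 : ℝ) ^ j) ^ (-(θ / 5))) * h ((1 / 2) ^ j * v)) ≤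
      ENNReal.ofReal C₁ * ⨆ j : ℕ,
        ENNReal.ofReal (C₂ * ((1 / 2 : ℝ) ^ j) ^ (2 * (θ / 5))) * H ((1 / 2) ^ j * u) := by
    intro u hu
    refine (h₁ (Ioo u t) (fun v hv => hu.1.trans hv.1)
      (fun j v => ENNReal.ofReal (((1 / 2 : ℝ) ^ j) ^ (-(θ / 5))) * h ((1 / 2) ^ j * v))
      fun j => (hh.comp (measurable_id.const_mul _)).const_mul _).trans ?_
    refine mul_le_mul_right (iSup_mono fun j => ?_) _
    rw [wnorm_const_mul ENNReal.ofReal_ne_top]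
    calc _ ≤ ENNReal.ofReal (((1 / 2 : ℝ) ^ j) ^ (-(θ / 5))) *
          (ENNReal.ofReal (((1 / 2 : ℝ) ^ j) ^ (-(θ / 5))) *
            (ENNReal.ofReal (C₂ * ((1 / 2 : ℝ) ^ j) ^ (-(θ / 5) - -θ)) *
              H ((1 / 2) ^ j * u))) := by
          gcongr
          refine (h₂ _ (hpos j) (hle j) u t hu.1.le h).trans ?_
          gcongr
          refine wnorm_mono_set (Ioo_subset_Ioo_right ?_) h
          exact mul_le_of_le_one_left (hu.1.trans hu.2).le (hle j)
      _ = _ := by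
          rw [← mul_assoc, ← mul_assoc, ← ENNReal.ofReal_mul (by positivity),
            ← ENNReal.ofReal_mul (by positivity), ← Real.rpow_add (hpos j), mul_left_comm,
            ← Real.rpow_add (hpos j)]
          ring_nf
  calc _ ≤ ENNReal.ofReal C₁ * wnorm r 0 b (Ioo 0 t) (fun u => ⨆ j : ℕ,
        ENNReal.ofReal (C₂ * ((1 / 2 : ℝ) ^ j) ^ (2 * (θ / 5))) * H ((1 / 2) ^ j * u)) :=
        wnorm_le_const_mul measurableSet_Ioo ENNReal.ofReal_ne_top inner
    _ ≤ ENNReal.ofReal C₁ * (ENNReal.ofReal C₃ *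
        (ENNReal.ofReal (C₂ * C₄) * wnorm r 0 b (Ioo 0 t) H)) := by
        gcongr
        refine (h₃ (Ioo 0 t) Ioo_subset_Ioi_self (fun j u =>
          ENNReal.ofReal (C₂ * ((1 / 2 : ℝ) ^ j) ^ (2 * (θ / 5))) * H ((1 / 2) ^ j * u))
          fun j => (hHm.comp (measurable_id.const_mul _)).const_mul _).trans ?_
        gcongr
        refine iSup_le fun j => ?_
        rw [wnorm_const_mul ENNReal.ofReal_ne_top]
        calc _ ≤ ENNReal.ofReal (((1 / 2 : ℝ) ^ j) ^ (-(θ / 5))) *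
              (ENNReal.ofReal (C₂ * ((1 / 2 : ℝ) ^ j) ^ (2 * (θ / 5))) *
                (ENNReal.ofReal (C₄ * ((1 / 2 : ℝ) ^ j) ^ (-(θ / 5) - 0)) *
                  wnorm r 0 b (Ioo 0 t) H)) := by
              gcongr
              refine (h₄ _ (hpos j) (hle j) 0 t le_rfl H).trans ?_
              gcongr
              refine wnorm_mono_set ?_ H
              rw [mul_zero]
              rcases le_total 0 t with ht | ht
              · exact Ioo_subset_Ioo_right (mul_le_of_le_one_left ht (hle j))
              · rw [Ioo_eq_empty (not_lt.2 (mul_nonpos_of_nonneg_of_nonpos (hpos j).le ht))]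
                exact empty_subset _
          _ = _ := by
              rw [← mul_assoc, ← mul_assoc, ← ENNReal.ofReal_mul (by positivity),
                ← ENNReal.ofReal_mul (by positivity)]
              congr 2
              rw [show ((1 / 2 : ℝ) ^ j) ^ (-(θ / 5)) * (C₂ * ((1 / 2 : ℝ) ^ j) ^ (2 * (θ / 5))) *
                (C₄ * ((1 / 2 : ℝ) ^ j) ^ (-(θ / 5) - 0)) = C₂ * C₄ *
                  (((1 / 2 : ℝ) ^ j) ^ (-(θ / 5)) * ((1 / 2 : ℝ) ^ j) ^ (2 * (θ / 5)) *
                    ((1 / 2 : ℝ) ^ j) ^ (-(θ / 5) - 0)) by ring,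
                ← Real.rpow_add (hpos j), ← Real.rpow_add (hpos j)]
              ring_nf
              simp
    _ = _ := by
        rw [← mul_assoc, ← mul_assoc, ← ENNReal.ofReal_mul hC₁.le,
          ← ENNReal.ofReal_mul (by positivity), mul_assoc]

theorem exists_normRL_iSup_dilation_le {θ : ℝ} (hθ : 0 < θ) {q r : ℝ≥0∞} (hq : q ≠ 0)
    (hr : r ≠ 0) (s : ℝ≥0∞) {a b : ℝ → ℝ} (ha : SlowlyVarying a) (hb : SlowlyVarying b)
    (c : ℝ → ℝ) :
    ∃ C : ℝ, 0 < C ∧ ∀ h : ℝ → ℝ≥0∞, Measurable h →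
      normRL (-θ) s c r b q a (fun v => ⨆ j : ℕ,
        ENNReal.ofReal (((1 / 2 : ℝ) ^ j) ^ (-(θ / 5))) * h ((1 / 2) ^ j * v)) ≤
      ENNReal.ofReal C * normRL (-θ) s c r b q a h := by
  obtain ⟨C, hC, H⟩ := exists_wnorm_wnorm_iSup_dilation_le hθ hq hr ha hb
  exact ⟨C, hC, fun h hh => wnorm_le_const_mul measurableSet_Ioi ENNReal.ofReal_ne_top
    fun t _ => H h hh t⟩

/-- The substitution `v = w ^ κ` in the iterated norm. -/
theorem normRL_rpow_substitution {κ : ℝ} (hκ : 0 < κ) (σ : ℝ) {q r s : ℝ≥0∞} (hq : q ≠ 0)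
    (hr : r ≠ 0) (hs : s ≠ 0) (a b c : ℝ → ℝ) (g : ℝ → ℝ≥0∞) :
    normRL σ s (fun t => c (t ^ (1 / κ))) r (fun t => b (t ^ (1 / κ))) q
        (fun t => a (t ^ (1 / κ))) g =
      ENNReal.ofReal (κ ^ (s⁻¹).toReal) * (ENNReal.ofReal (κ ^ (r⁻¹).toReal) *
        (ENNReal.ofReal (κ ^ (q⁻¹).toReal) *
          normRL (σ * κ) s c r b q a fun w => g (w ^ κ))) := by
  have key : ∀ {p : ℝ≥0∞}, p ≠ 0 → ∀ (τ : ℝ) (d : ℝ → ℝ) {I J : Set ℝ}, MeasurableSet I →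
      I ⊆ Ioi 0 → MeasurableSet J → (fun x : ℝ => x ^ κ) '' I = J → ∀ F : ℝ → ℝ≥0∞,
      wnorm p τ (fun t => d (t ^ (1 / κ))) J F =
        ENNReal.ofReal (κ ^ (p⁻¹).toReal) * wnorm p (τ * κ) d I fun x => F (x ^ κ) := by
    intro p hp τ d I J hI hI0 hJ hIJ F
    rw [wnorm_image hp one_pos hκ τ _ hI hI0 hJ (by simpa only [one_mul] using hIJ)]
    simp only [one_mul, Real.one_rpow, mul_one]
    congr 1
    refine wnorm_congr hI fun x hx => ?_
    rw [← Real.rpow_mul (hI0 hx).le, mul_one_div_cancel hκ.ne', Real.rpow_one]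
  have image_Ioo : ∀ {u t : ℝ}, 0 ≤ u → 0 ≤ t → (fun x : ℝ => x ^ κ) '' Ioo u t = Ioo (u ^ κ) (t ^ κ) := by
    intro u t hu ht
    ext y
    constructor
    · rintro ⟨x, hx, rfl⟩
      exact ⟨Real.rpow_lt_rpow hu hx.1 hκ, Real.rpow_lt_rpow (hu.trans hx.1.le) hx.2 hκ⟩
    · intro hy
      have hy0 : 0 < y := (Real.rpow_nonneg hu κ).trans_lt hy.1
      refine ⟨y ^ κ⁻¹, ⟨?_, ?_⟩, Real.rpow_inv_rpow hy0.le hκ.ne'⟩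
      · exact (Real.lt_rpow_inv_iff_of_pos hu hy0.le hκ).2 hy.1
      · exact (Real.rpow_inv_lt_iff_of_pos hy0.le ht hκ).2 hy.2
  have image_Ioi : (fun x : ℝ => x ^ κ) '' Ioi 0 = Ioi 0 := by
    ext y
    constructor
    · rintro ⟨x, hx, rfl⟩
      exact Real.rpow_pos_of_pos hx κ
    · intro (hy : 0 < y)
      exact ⟨y ^ κ⁻¹, Real.rpow_pos_of_pos hy _, Real.rpow_inv_rpow hy.le hκ.ne'⟩
  have middle : ∀ t : ℝ, 0 < t →
      wnorm r 0 (fun t => b (t ^ (1 / κ))) (Ioo 0 (t ^ κ)) (fun u =>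
        wnorm q σ (fun t => a (t ^ (1 / κ))) (Ioo u (t ^ κ)) g) =
      ENNReal.ofReal (κ ^ (r⁻¹).toReal) * (ENNReal.ofReal (κ ^ (q⁻¹).toReal) *
        wnorm r 0 b (Ioo 0 t) fun u => wnorm q (σ * κ) a (Ioo u t) fun w => g (w ^ κ)) := by
    intro t ht
    rw [key hr 0 b (measurableSet_Ioo (a := 0) (b := t)) Ioo_subset_Ioi_self measurableSet_Ioo
      (by rw [image_Ioo le_rfl ht.le, Real.zero_rpow hκ.ne']), zero_mul]
    congr 1
    refine (wnorm_congr measurableSet_Ioo fun u hu => congrArg _ ?_).trans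
      (wnorm_const_mul ENNReal.ofReal_ne_top _)
    exact key hq σ a measurableSet_Ioo (fun v hv => hu.1.trans hv.1) measurableSet_Ioo
      (image_Ioo hu.1.le (hu.1.trans hu.2).le) g
  rw [normRL, key hs 0 c measurableSet_Ioi subset_rfl measurableSet_Ioi image_Ioi, zero_mul]
  congr 1
  refine (wnorm_congr measurableSet_Ioi fun t ht => congrArg _ (middle t ht)).trans ?_
  rw [wnorm_const_mul ENNReal.ofReal_ne_top, wnorm_const_mul ENNReal.ofReal_ne_top, normRL]

/-! ### Identification of the spaces -/

theorem normRL_lorentz_eq {κ θ : ℝ} (hκ : 0 < κ) {q r s : ℝ≥0∞} (hq : q ≠ 0) (hr : r ≠ 0)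
    (hs : s ≠ 0) (a b c : ℝ → ℝ) {Ω : Type*} [MeasurableSpace Ω] {μ : Measure Ω} {𝕜 : Type*}
    [RCLike 𝕜] (f : Ω →ₘ[μ] 𝕜) :
    normRL ((1 - θ) / κ) s (fun t => c (t ^ (1 / κ))) r (fun t => b (t ^ (1 / κ))) q
        (fun t => a (t ^ (1 / κ))) (rearr f) =
      ENNReal.ofReal (κ ^ (s⁻¹).toReal * κ ^ (r⁻¹).toReal * κ ^ (q⁻¹).toReal) *
        normRL (-θ) s c r b q a (powRearr κ f) := by
  have h : normRL (1 - θ) s c r b q a (fun w => rearr f (w ^ κ)) =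
      normRL (-θ) s c r b q a (powRearr κ f) := by
    refine wnorm_congr measurableSet_Ioi fun t _ => ?_
    congr 1
    refine wnorm_congr measurableSet_Ioo fun u hu => ?_
    congr 1
    refine wnorm_congr measurableSet_Ioo fun v hv => ?_
    have hv0 : 0 < v := hu.1.trans hv.1
    rw [powRearr, ← mul_assoc, ← ENNReal.ofReal_mul' hv0.le]
    congr 2
    rw [show 1 - θ - (q⁻¹).toReal = (-θ - (q⁻¹).toReal) + 1 by ring, Real.rpow_add_one hv0.ne']
    ring
  rw [normRL_rpow_substitution hκ _ hq hr hs, div_mul_cancel₀ _ hκ.ne', h, ← mul_assoc,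
    ← mul_assoc, ← ENNReal.ofReal_mul (by positivity), ← ENNReal.ofReal_mul (by positivity)]

/-- An element with finite extremal quasi-norm lies in the sum of the couple. -/
theorem mem_extremalRL_of_lt_top {Ω : Type*} [MeasurableSpace Ω] {μ : Measure Ω} {𝕜 : Type*}
    [RCLike 𝕜] {A₀ A₁ : FunctionSpace 𝕜 μ} {θ : ℝ} {q r s : ℝ≥0∞} (hq : q ≠ 0) (hr : r ≠ 0)
    (hs : s ≠ 0) {a b c : ℝ → ℝ} (ha : SlowlyVarying a) (hb : SlowlyVarying b)
    (hc : SlowlyVarying c) {f : Ω →ₘ[μ] 𝕜}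
    (hf : normRL (-θ) s c r b q a (peetreK A₀ A₁ f) < ∞) :
    f ∈ (extremalRL A₀ A₁ θ s c r b q a).carrier := by
  refine ⟨?_, hf⟩
  by_contra hdec
  have hK : peetreK A₀ A₁ f = fun _ => ∞ := by
    funext t
    refine top_le_iff.1 (le_iInf₂ fun f₀ h₀ => le_iInf₂ fun f₁ h₁ => le_iInf fun h => ?_)
    exact absurd ⟨f₀, h₀, f₁, h₁, h⟩ hdec
  rw [hK, normRL_top hq hr hs ha hb hc] at hf
  exact lt_irrefl _ hf

theorem inv_div_ofReal_toReal {κ θ : ℝ} (hκ : 0 < κ) (hθ : θ ≤ 1) :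
    ((ENNReal.ofReal κ / ENNReal.ofReal (1 - θ))⁻¹).toReal = (1 - θ) / κ := by
  rw [ENNReal.inv_div (Or.inl ENNReal.ofReal_ne_top) (Or.inr (by simpa using hκ)),
    ENNReal.toReal_div, ENNReal.toReal_ofReal hκ.le, ENNReal.toReal_ofReal (by linarith)]

theorem exists_normRL_peetreK_leb_le {θ κ : ℝ} (hθ : 0 < θ) (hκ : 0 < κ) {q r : ℝ≥0∞}
    (hq : q ≠ 0) (hr : r ≠ 0) (s : ℝ≥0∞) {a b : ℝ → ℝ} (ha : SlowlyVarying a)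
    (hb : SlowlyVarying b) (c : ℝ → ℝ) {Ω : Type*} [MeasurableSpace Ω] (μ : Measure Ω)
    (𝕜 : Type*) [RCLike 𝕜] :
    ∃ C : ℝ, 0 < C ∧ ∀ f : Ω →ₘ[μ] 𝕜,
      normRL (-θ) s c r b q a (peetreK (Leb 𝕜 μ (ENNReal.ofReal κ)) (Leb 𝕜 μ ∞) f) ≤
        ENNReal.ofReal C * normRL (-θ) s c r b q a (powRearr κ f) := by
  obtain ⟨C₁, hC₁, h₁⟩ := exists_peetreK_leb_le (μ := μ) (𝕜 := 𝕜) hκ (ε := θ / 5) (by positivity)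
  obtain ⟨C₂, hC₂, h₂⟩ := exists_normRL_iSup_dilation_le hθ hq hr s ha hb c
  refine ⟨C₁ * C₂, by positivity, fun f => ?_⟩
  refine (normRL_mono fun t ht => h₁ f t ht).trans ?_
  rw [normRL_const_mul ENNReal.ofReal_ne_top, ENNReal.ofReal_mul hC₁.le, mul_assoc]
  gcongr
  exact h₂ _ (measurable_powRearr κ f)

end RLInterp

theorem theorem5p7 {Ω : Type*} [MeasurableSpace Ω] (μ : Measure Ω) [SigmaFinite μ]
    (hμ : RLInterp.NonAtomic μ) (𝕜 : Type*) [RCLike 𝕜]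
    (θ κ : ℝ) (hθ₀ : 0 < θ) (hθ₁ : θ ≤ 1) (hκ : 0 < κ)
    (p : ℝ≥0∞) (hp : p = ENNReal.ofReal κ / ENNReal.ofReal (1 - θ))
    (q r s : ℝ≥0∞) (hq : 0 < q) (hr : 0 < r) (hs : 0 < s)
    (a b c : ℝ → ℝ) (ha : RLInterp.SlowlyVarying a) (hb : RLInterp.SlowlyVarying b)
    (hc : RLInterp.SlowlyVarying c) :
    (RLInterp.extremalRL (RLInterp.Leb 𝕜 μ (ENNReal.ofReal κ)) (RLInterp.Leb 𝕜 μ ∞)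
        θ s c r b q a).Same
      (RLInterp.extremalRL (RLInterp.WeakLeb 𝕜 μ κ) (RLInterp.Leb 𝕜 μ ∞) θ s c r b q a) ∧
    (RLInterp.extremalRL (RLInterp.WeakLeb 𝕜 μ κ) (RLInterp.Leb 𝕜 μ ∞) θ s c r b q a).Same
      (RLInterp.LorentzKaramataRL 𝕜 μ p s (fun t => c (t ^ (1 / κ))) r (fun t => b (t ^ (1 / κ)))
        q (fun t => a (t ^ (1 / κ)))) := by
  obtain ⟨C, hC, hCK⟩ := RLInterp.exists_normRL_peetreK_leb_le hθ₀ hκ hq.ne' hr.ne' s ha hb c μ 𝕜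
  have hWL : ∀ f : Ω →ₘ[μ] 𝕜, RLInterp.normRL (-θ) s c r b q a
      (RLInterp.peetreK (RLInterp.WeakLeb 𝕜 μ κ) (RLInterp.Leb 𝕜 μ ∞) f) ≤
      RLInterp.normRL (-θ) s c r b q a
        (RLInterp.peetreK (RLInterp.Leb 𝕜 μ (ENNReal.ofReal κ)) (RLInterp.Leb 𝕜 μ ∞) f) :=
    fun f => RLInterp.normRL_mono fun t _ => RLInterp.peetreK_weakLeb_le hκ f t
  have hPW : ∀ f : Ω →ₘ[μ] 𝕜, RLInterp.normRL (-θ) s c r b q a (RLInterp.powRearr κ f) ≤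
      RLInterp.normRL (-θ) s c r b q a
        (RLInterp.peetreK (RLInterp.WeakLeb 𝕜 μ κ) (RLInterp.Leb 𝕜 μ ∞) f) :=
    fun f => RLInterp.normRL_mono fun t ht => RLInterp.powRearr_le_peetreK hκ f ht
  set D : ℝ := κ ^ (s⁻¹).toReal * κ ^ (r⁻¹).toReal * κ ^ (q⁻¹).toReal with hD
  have hD0 : 0 < D := by positivity
  have hLK : ∀ f : Ω →ₘ[μ] 𝕜, (RLInterp.LorentzKaramataRL 𝕜 μ p s (fun t => c (t ^ (1 / κ))) r
      (fun t => b (t ^ (1 / κ))) q (fun t => a (t ^ (1 / κ)))).qnorm f =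
      ENNReal.ofReal D * RLInterp.normRL (-θ) s c r b q a (RLInterp.powRearr κ f) := by
    intro f
    rw [hD, ← RLInterp.normRL_lorentz_eq hκ hq.ne' hr.ne' hs.ne',
      ← RLInterp.inv_div_ofReal_toReal hκ hθ₁, ← hp]
    rfl
  have hPL : ∀ f : Ω →ₘ[μ] 𝕜, RLInterp.normRL (-θ) s c r b q a (RLInterp.powRearr κ f) =
      ENNReal.ofReal D⁻¹ * (RLInterp.LorentzKaramataRL 𝕜 μ p s (fun t => c (t ^ (1 / κ))) r
        (fun t => b (t ^ (1 / κ))) q (fun t => a (t ^ (1 / κ)))).qnorm f := by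
    intro f
    rw [hLK, ← mul_assoc, ← ENNReal.ofReal_mul (by positivity), inv_mul_cancel₀ hD0.ne',
      ENNReal.ofReal_one, one_mul]
  refine ⟨⟨⟨?_, 1, one_pos, ?_⟩, ?_, C, hC, ?_⟩, ⟨?_, D, hD0, ?_⟩, ?_, C * D⁻¹, by positivity, ?_⟩
  · rintro f ⟨-, hf⟩
    exact RLInterp.mem_extremalRL_of_lt_top hq.ne' hr.ne' hs.ne' ha hb hc ((hWL f).trans_lt hf)
  · intro f _
    rw [ENNReal.ofReal_one, one_mul]
    exact hWL f
  · rintro f ⟨-, hf⟩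
    refine RLInterp.mem_extremalRL_of_lt_top hq.ne' hr.ne' hs.ne' ha hb hc ((hCK f).trans_lt ?_)
    exact ENNReal.mul_lt_top ENNReal.ofReal_lt_top ((hPW f).trans_lt hf)
  · intro f _
    exact (hCK f).trans (mul_le_mul_right (hPW f) _)
  · rintro f ⟨-, hf⟩
    refine (hLK f).trans_lt ?_
    exact ENNReal.mul_lt_top ENNReal.ofReal_lt_top ((hPW f).trans_lt hf)
  · intro f _
    rw [hLK]
    exact mul_le_mul_right (hPW f) _
  · intro f hf
    refine RLInterp.mem_extremalRL_of_lt_top hq.ne' hr.ne' hs.ne' ha hb hc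
      ((hWL f).trans_lt ((hCK f).trans_lt (ENNReal.mul_lt_top ENNReal.ofReal_lt_top ?_)))
    rw [hPL]
    exact ENNReal.mul_lt_top ENNReal.ofReal_lt_top hf
  · intro f _
    rw [ENNReal.ofReal_mul hC.le, mul_assoc, ← hPL]
    exact (hWL f).trans (hCK f)
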